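/- Let $n\ge 1$, let $\Omega\subseteq\mathbb C^n$ be a domain (a non-empty connected open set), and let $\mathcal F$ be a family of holomorphic functions $\Omega\to\mathbb C$ without zeros in $\Omega$. For $f\in\mathcal F$ and a non-empty open set $D$ with $\overline D\subset\Omega$ put $$m(f,D)=\begin{cases}\displaystyle\sup_{z,w\in D}\frac{\ln|f(z)|}{\ln|f(w)|}, & \text{if } |f(w)|\neq 1 \text{ for all } w\in D,\\[2mm] +\infty, & \text{if } |f(w)|=1 \text{ for some } w\in D,\end{cases}$$ $$m'(f,D)=\sup_{z,w\in D}\frac{|f(z)|}{|f(w)|},\qquad L(f,D)=\min\{m(f,D),\,m'(f,D)\},$$ with values in the extended reals. Call $\mathcal F$ normal in $\Omega$ if every sequence in $\mathcal F$ has a subsequence that either converges uniformly on each compact subset of $\Omega$ to a complex-valued limit function, or converges uniformly to $\infty$ on each compact subset of $\Omega$. Then $\mathcal F$ is normal in $\Omega$ if and only if for each point $z_0\in\Omega$ there are $r_0>0$ and a real constant $C$ such that the Euclidean ball $B(z_0,r_0)$ satisfies $\overline{B(z_0,r_0)}\subset\Omega$ and $L(f,B(z_0,r_0))\le C$ for all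 $f\in\mathcal F$. -/

import Mathlib

namespace Mandelbrojt

open Filter

/-- A family `F` of functions is normal in `Ω ⊆ ℂⁿ`: every sequence in `F` has a subsequence that
either converges uniformly on every compact subset of `Ω` to a (finite, complex valued) limit
function, or converges uniformly to `∞` on every compact subset of `Ω`. -/
def IsNormalFamily {n : ℕ} (F : Set (EuclideanSpace ℂ (Fin n) → ℂ))
    (Ω : Set (EuclideanSpace ℂ (Fin n))) : Prop :=
  ∀ u : ℕ → EuclideanSpace ℂ (Fin n) → ℂ, (∀ k, u k ∈ F) →
    ∃ φ : ℕ → ℕ, StrictMono φ ∧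
      ((∃ g : EuclideanSpace ℂ (Fin n) → ℂ, ∀ K ⊆ Ω, IsCompact K →
          TendstoUniformlyOn (fun k => u (φ k)) g atTop K) ∨
        (∀ K ⊆ Ω, IsCompact K → ∀ M : ℝ, ∀ᶠ k in atTop, ∀ z ∈ K, M < ‖u (φ k) z‖))

open Classical in
/-- `m(f, D)`: the supremum over `z, w ∈ D` of `ln |f z| / ln |f w|` if `|f| ≠ 1` everywhere on
`D`, and `∞` if `|f w| = 1` for some `w ∈ D`. -/
noncomputable def logRatioSup {n : ℕ} (f : EuclideanSpace ℂ (Fin n) → ℂ)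
    (D : Set (EuclideanSpace ℂ (Fin n))) : EReal :=
  if ∀ w ∈ D, ‖f w‖ ≠ 1 then
    ⨆ z ∈ D, ⨆ w ∈ D, ((Real.log ‖f z‖ / Real.log ‖f w‖ : ℝ) : EReal)
  else ⊤

/-- `m'(f, D)`: the supremum over `z, w ∈ D` of `|f z| / |f w|`. -/
noncomputable def ratioSup {n : ℕ} (f : EuclideanSpace ℂ (Fin n) → ℂ)
    (D : Set (EuclideanSpace ℂ (Fin n))) : EReal :=
  ⨆ z ∈ D, ⨆ w ∈ D, ((‖f z‖ / ‖f w‖ : ℝ) : EReal)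

/-- `L(f, D) = min (m(f, D), m'(f, D))`. -/
noncomputable def minRatio {n : ℕ} (f : EuclideanSpace ℂ (Fin n) → ℂ)
    (D : Set (EuclideanSpace ℂ (Fin n))) : EReal :=
  min (logRatioSup f D) (ratioSup f D)

end Mandelbrojt

open Filter Metric Set
open scoped Topology

/-! Harnack's inequality makes `L` locally bounded on a normal family. Where `|f| > 1`, it controls
ratios of `log |f|`; where `|f| < M`, it is applied to `M / f` and controls either the logarithmic
ratio (`f` uniformly small) or the plain ratio. Conversely, a bound on `L` propagates bounds on
`|f|` from one point to a whole ball (`norm_le_of_minRatio_le`). By connectedness, boundedness of a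
sequence at one point, or divergence to infinity there, then spreads over `Ω`. Montel's theorem
handles the bounded case, compactness the divergent one. -/

/-- **Harnack inequality** on a disc, for the logarithm of a holomorphic function. -/
theorem Complex.log_norm_le_of_one_lt_norm {h : ℂ → ℂ} {R : ℝ} {z : ℂ}
    (hd : DifferentiableOn ℂ h (ball 0 R)) (h1 : ∀ t ∈ ball (0 : ℂ) R, 1 < ‖h t‖)
    (hz : z ∈ ball (0 : ℂ) R) :
    Real.log ‖h z‖ ≤ (R + ‖z‖) / (R - ‖z‖) * Real.log ‖h 0‖ := by
  have hR : 0 < R := nonempty_ball.1 ⟨z, hz⟩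
  have h0 : (0 : ℂ) ∈ ball (0 : ℂ) R := mem_ball_self hR
  have hne : ∀ t ∈ ball (0 : ℂ) R, h t ≠ 0 := fun t ht e => by
    have := h1 t ht
    simp [e] at this
    linarith
  obtain ⟨G, hG⟩ := ((hd.deriv isOpen_ball).div hd hne).isExactOn_ball
  have hconst : ∀ t ∈ ball (0 : ℂ) R, h t * Complex.exp (-(G t - G 0)) = h 0 := by
    have key : ∀ t ∈ ball (0 : ℂ) R,
        HasDerivAt (fun t => h t * Complex.exp (-(G t - G 0))) 0 t := by
      intro t ht
      have hh := (hd.differentiableAt (isOpen_ball.mem_nhds ht)).hasDerivAt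
      refine (hh.fun_mul ((hG t ht).sub_const (G 0)).fun_neg.cexp).congr_deriv ?_
      have := hne t ht
      simp only [Pi.div_apply]
      field_simp
      ring
    intro t ht
    have := (convex_ball (0 : ℂ) R).is_const_of_fderivWithin_eq_zero (𝕜 := ℂ)
      (f := fun t => h t * Complex.exp (-(G t - G 0)))
      (fun t ht => (key t ht).differentiableAt.differentiableWithinAt)
      (fun t ht => by
        rw [fderivWithin_of_isOpen isOpen_ball ht]
        ext
        simpa using (key t ht).deriv) ht h0
    simpa using this
  have hre : ∀ t ∈ ball (0 : ℂ) R, (-(G t - G 0)).re = Real.log ‖h 0‖ - Real.log ‖h t‖ := by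
    intro t ht
    rw [← hconst t ht, norm_mul, Complex.norm_exp,
      Real.log_mul (norm_ne_zero_iff.2 (hne t ht)) (Real.exp_pos _).ne', Real.log_exp]
    ring
  have hM : 0 < Real.log ‖h 0‖ := Real.log_pos (h1 0 h0)
  -- This function vanishes at 0 and, as `|h| > 1`, has real part below `log |h 0|`.
  have hb := Complex.borelCaratheodory_zero (f := fun t => -(G t - G 0)) hM
    (fun t ht => ((hG t ht).sub_const (G 0)).neg.differentiableAt.differentiableWithinAt)
    (fun t ht => by
      have := Real.log_pos (h1 t ht)
      simp only [mem_ofPred_eq, hre t ht]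
      linarith) hR hz (by simp)
  have h2 := (abs_le.1 (Complex.abs_re_le_norm (-(G z - G 0)))).1
  rw [hre z hz] at h2
  have hzR : 0 < R - ‖z‖ := by simpa using hz
  have : (R + ‖z‖) / (R - ‖z‖) * Real.log ‖h 0‖ =
      Real.log ‖h 0‖ + 2 * Real.log ‖h 0‖ * ‖z‖ / (R - ‖z‖) := by
    field_simp
    ring
  linarith

section

variable {E : Type*} [NormedAddCommGroup E] [NormedSpace ℂ E]

/-- Restrict to the complex line through `c` and `z`, with `z` at parameter 1 in a disc of radius 2:
the Harnack factor is (2 + 1) / (2 - 1) = 3. -/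
theorem log_norm_le_three_mul_of_one_lt_norm {f : E → ℂ} {c z : E} {R : ℝ}
    (hd : DifferentiableOn ℂ f (ball c R)) (h1 : ∀ w ∈ ball c R, 1 < ‖f w‖)
    (hR : 0 < R) (hz : dist z c ≤ R / 2) :
    Real.log ‖f z‖ ≤ 3 * Real.log ‖f c‖ := by
  have hmaps : MapsTo (fun t : ℂ => c + t • (z - c)) (ball 0 2) (ball c R) := by
    intro t ht
    rw [mem_ball_zero_iff] at ht
    rw [mem_ball, dist_eq_norm, add_sub_cancel_left, norm_smul]
    rw [dist_eq_norm] at hz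
    nlinarith [norm_nonneg t, norm_nonneg (z - c)]
  have := Complex.log_norm_le_of_one_lt_norm (h := fun t : ℂ => f (c + t • (z - c))) (R := 2)
    (z := 1) (hd.comp (by fun_prop) hmaps) (fun t ht => h1 _ (hmaps ht)) (by simp)
  norm_num at this
  exact this

/-- **Montel's theorem**: a locally bounded sequence of holomorphic functions has a subsequence
that converges uniformly on compact sets. -/
theorem exists_subseq_tendstoUniformlyOn_of_locally_bounded [ProperSpace E] {Ω : Set E}
    (hΩ : IsOpen Ω) {v : ℕ → E → ℂ} (hd : ∀ k, DifferentiableOn ℂ (v k) Ω)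
    (hb : ∀ z ∈ Ω, ∃ r > 0, ∃ M, ∀ k, ∀ w ∈ ball z r, ‖v k w‖ ≤ M) :
    ∃ φ : ℕ → ℕ, StrictMono φ ∧ ∃ g : E → ℂ, ∀ K ⊆ Ω, IsCompact K →
      TendstoUniformlyOn (fun k => v (φ k)) g atTop K := by
  classical
  have : LocallyCompactSpace Ω := hΩ.locallyCompactSpace
  let V : ℕ → C(Ω, ℂ) := fun k => ⟨Ω.domRestrict (v k), (hd k).continuousOn.domRestrict⟩
  -- Equicontinuity comes from the Schwarz lemma and the local bounds.
  have heq : Equicontinuous (fun (f : range V) (x : Ω) => (f : C(Ω, ℂ)) x) := by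
    intro x
    obtain ⟨r, hr, M, hM⟩ := hb x x.2
    obtain ⟨ε, hε, hεΩ⟩ := Metric.isOpen_iff.1 hΩ x x.2
    have hρ : 0 < min r ε := lt_min hr hε
    refine Metric.equicontinuousAt_of_continuity_modulus
      (fun y : Ω => 2 * M / min r ε * dist (y : E) x) ?_ _ ?_
    · have : Continuous (fun y : Ω => 2 * M / min r ε * dist (y : E) x) := by fun_prop
      simpa using this.tendsto x
    · have hn : ∀ᶠ y : Ω in 𝓝 x, (y : E) ∈ ball (x : E) (min r ε) :=
        continuous_subtype_val.continuousAt.eventually (ball_mem_nhds _ hρ)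
      filter_upwards [hn] with y hy
      rintro ⟨_, k, rfl⟩
      rw [dist_comm]
      refine Complex.dist_le_div_mul_dist_of_mapsTo_ball (f := v k)
        ((hd k).mono ((ball_subset_ball (min_le_right _ _)).trans hεΩ)) ?_ hy
      intro w hw
      have h1 := hM k w (ball_subset_ball (min_le_left _ _) hw)
      have h2 := hM k x (mem_ball_self hr)
      rw [mem_closedBall, dist_eq_norm]
      linarith [norm_sub_le (v k w) (v k x)]
  have : T2Space (UniformOnFun Ω ℂ {K | IsCompact K}) := UniformOnFun.t2Space_of_covering <|
    eq_univ_of_forall fun x => mem_sUnion_of_mem (mem_singleton x) isCompact_singleton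
  have hcpt : IsCompact (closure (range V)) := by
    refine ArzelaAscoli.isCompact_closure_of_isClosedEmbedding
      (F := fun f : C(Ω, ℂ) => (f : Ω → ℂ)) (𝔖 := {K | IsCompact K}) (fun _ h => h)
      (ContinuousMap.isUniformEmbedding_toUniformOnFunIsCompact.isClosedEmbedding)
      (fun K _ => heq.equicontinuousOn K) ?_
    intro K _ x _
    obtain ⟨r, hr, M, hM⟩ := hb x x.2
    refine ⟨closedBall 0 M, isCompact_closedBall _ _, ?_⟩
    rintro _ ⟨k, rfl⟩
    exact mem_closedBall_zero_iff.2 (hM k x (mem_ball_self hr))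
  obtain ⟨G, -, φ, hφ, hG⟩ := hcpt.tendsto_subseq (fun k => subset_closure (mem_range_self k))
  rw [ContinuousMap.tendsto_iff_forall_isCompact_tendstoUniformlyOn] at hG
  refine ⟨φ, hφ, fun x => if hx : x ∈ Ω then G ⟨x, hx⟩ else 0, fun K hK hKc => ?_⟩
  have hK' := hG ((↑) ⁻¹' K : Set Ω) (Topology.IsInducing.subtypeVal.isCompact_preimage' hKc
    (by simpa using hK))
  rw [Metric.tendstoUniformlyOn_iff] at hK' ⊢
  intro ε hε
  filter_upwards [hK' ε hε] with k hk x hx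
  simp only [hK hx, dif_pos]
  exact hk ⟨x, hK hx⟩ hx

end

/-! ### Bounds for `L` and what they imply -/

namespace Mandelbrojt

variable {n : ℕ} {f : EuclideanSpace ℂ (Fin n) → ℂ} {D : Set (EuclideanSpace ℂ (Fin n))}

theorem ratioSup_le {C : ℝ} (h : ∀ z ∈ D, ∀ w ∈ D, ‖f z‖ / ‖f w‖ ≤ C) : ratioSup f D ≤ C :=
  iSup₂_le fun z hz => iSup₂_le fun w hw => EReal.coe_le_coe_iff.2 (h z hz w hw)

theorem logRatioSup_le {C : ℝ} (h1 : ∀ w ∈ D, ‖f w‖ ≠ 1)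
    (h : ∀ z ∈ D, ∀ w ∈ D, Real.log ‖f z‖ / Real.log ‖f w‖ ≤ C) : logRatioSup f D ≤ C := by
  rw [logRatioSup, if_pos h1]
  exact iSup₂_le fun z hz => iSup₂_le fun w hw => EReal.coe_le_coe_iff.2 (h z hz w hw)

theorem minRatio_le_iff {C : ℝ} : minRatio f D ≤ C ↔
    ((∀ w ∈ D, ‖f w‖ ≠ 1) ∧ ∀ z ∈ D, ∀ w ∈ D, Real.log ‖f z‖ / Real.log ‖f w‖ ≤ C) ∨
      ∀ z ∈ D, ∀ w ∈ D, ‖f z‖ / ‖f w‖ ≤ C := by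
  constructor
  · intro h
    rcases min_le_iff.1 h with h | h
    · left
      by_cases h1 : ∀ w ∈ D, ‖f w‖ ≠ 1
      · rw [logRatioSup, if_pos h1] at h
        refine ⟨h1, fun z hz w hw => EReal.coe_le_coe_iff.1 (le_trans ?_ h)⟩
        exact le_iSup₂_of_le z hz (le_iSup₂_of_le w hw le_rfl)
      · rw [logRatioSup, if_neg h1] at h
        exact absurd (top_le_iff.1 h) (EReal.coe_ne_top C)
    · right
      refine fun z hz w hw => EReal.coe_le_coe_iff.1 (le_trans ?_ h)
      exact le_iSup₂_of_le z hz (le_iSup₂_of_le w hw le_rfl)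
  · rintro (⟨h1, h⟩ | h)
    · exact min_le_of_left_le (logRatioSup_le h1 h)
    · exact min_le_of_right_le (ratioSup_le h)

theorem minRatio_le_of_one_lt_norm {c : EuclideanSpace ℂ (Fin n)} {R : ℝ}
    (hd : DifferentiableOn ℂ f (ball c (2 * R))) (h1 : ∀ w ∈ ball c (2 * R), 1 < ‖f w‖)
    (hR : 0 < R) : minRatio f (ball c (R / 4)) ≤ (3 : ℝ) := by
  have hsub : ball c (R / 4) ⊆ ball c (2 * R) := ball_subset_ball (by linarith)
  refine minRatio_le_iff.2 (.inl ⟨fun w hw => (h1 w (hsub hw)).ne', fun z hz w hw => ?_⟩)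
  rw [div_le_iff₀ (Real.log_pos (h1 w (hsub hw)))]
  rw [mem_ball] at hz hw
  have hsub' : ball w R ⊆ ball c (2 * R) := ball_subset_ball' (by linarith)
  exact log_norm_le_three_mul_of_one_lt_norm (hd.mono hsub') (fun x hx => h1 x (hsub' hx)) hR
    (by linarith [dist_triangle_right z w c])

theorem minRatio_le_of_norm_lt {c : EuclideanSpace ℂ (Fin n)} {R M : ℝ}
    (hd : DifferentiableOn ℂ f (ball c (2 * R))) (h0 : ∀ w ∈ ball c (2 * R), f w ≠ 0)
    (hM : 1 < M) (hfM : ∀ w ∈ ball c (2 * R), ‖f w‖ < M) (hR : 0 < R) :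
    minRatio f (ball c (R / 4)) ≤ (max 5 (Real.exp (6 * Real.log M)) : ℝ) := by
  have hsub : ball c (R / 4) ⊆ ball c (2 * R) := ball_subset_ball (by linarith)
  have hpos : ∀ w ∈ ball c (2 * R), 0 < ‖f w‖ := fun w hw => norm_pos_iff.2 (h0 w hw)
  have hM0 : 0 < M := by linarith
  have hA : 0 < Real.log M := Real.log_pos hM
  have hnorm : ∀ w, ‖(M : ℂ) / f w‖ = M / ‖f w‖ := fun w => by
    rw [norm_div, Complex.norm_real, Real.norm_of_nonneg hM0.le]
  have harnack : ∀ z ∈ ball c (R / 4), ∀ w ∈ ball c (R / 4),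
      Real.log M - Real.log ‖f z‖ ≤ 3 * (Real.log M - Real.log ‖f w‖) := by
    intro z hz w hw
    have hz' := hpos z (hsub hz)
    have hw' := hpos w (hsub hw)
    rw [mem_ball] at hz hw
    have hsub' : ball w R ⊆ ball c (2 * R) := ball_subset_ball' (by linarith)
    have := log_norm_le_three_mul_of_one_lt_norm (f := fun x => (M : ℂ) / f x) (c := w) (z := z)
      (((hd.mono hsub').fun_inv fun x hx => h0 x (hsub' hx)).const_mul _)
      (fun x hx => by
        rw [hnorm, one_lt_div (hpos x (hsub' hx))]
        exact hfM x (hsub' hx)) hR (by linarith [dist_triangle_right z w c])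
    rwa [hnorm, hnorm, Real.log_div hM0.ne' hz'.ne', Real.log_div hM0.ne' hw'.ne'] at this
  have hlt : ∀ w ∈ ball c (R / 4), Real.log ‖f w‖ < Real.log M := fun w hw =>
    Real.log_lt_log (hpos w (hsub hw)) (hfM w (hsub hw))
  rw [minRatio_le_iff]
  -- With `A = log M`: if `log |f| ≤ -A` throughout, `harnack` yields `log |f z| ≥ 3 log |f w| - 2A
  -- ≥ 5 log |f w|`. Otherwise, comparison with a point `w₀` where `log |f| > -A` yields `A - log |f
  -- w| < 6A`.
  by_cases hsmall : ∀ w ∈ ball c (R / 4), Real.log ‖f w‖ ≤ -Real.log M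
  · refine .inl ⟨fun w hw h => ?_, fun z hz w hw => le_max_of_le_left ?_⟩
    · have := hsmall w hw
      rw [h, Real.log_one] at this
      linarith
    · have := hsmall w hw
      rw [div_le_iff_of_neg (by linarith)]
      linarith [harnack z hz w hw]
  · push Not at hsmall
    obtain ⟨w₀, hw₀, hlog⟩ := hsmall
    refine .inr fun z hz w hw => le_max_of_le_right ?_
    rw [← Real.log_le_iff_le_exp (div_pos (hpos z (hsub hz)) (hpos w (hsub hw))),
      Real.log_div (hpos z (hsub hz)).ne' (hpos w (hsub hw)).ne']
    linarith [harnack w hw w₀ hw₀, hlt z hz]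

/-- Under a bound on `L(f, D)`, a bound on `|f|` at one point of `D` gives a bound on all of `D`
that does not depend on `f`. -/
theorem norm_le_of_minRatio_le {C M : ℝ} (hD : IsPreconnected D) (hc : ContinuousOn f D)
    (h0 : ∀ w ∈ D, f w ≠ 0) (hL : minRatio f D ≤ C) (hC : 1 ≤ C) (hM : 1 ≤ M)
    {z w : EuclideanSpace ℂ (Fin n)} (hz : z ∈ D) (hw : w ∈ D) (hfw : ‖f w‖ ≤ M) :
    ‖f z‖ ≤ max (C * M) (Real.exp (C * Real.log M)) := by
  have hzpos := norm_pos_iff.2 (h0 z hz)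
  have hwpos := norm_pos_iff.2 (h0 w hw)
  rcases minRatio_le_iff.1 hL with ⟨h1, h⟩ | h
  · refine le_max_of_le_right ?_
    rw [← Real.log_le_iff_le_exp hzpos]
    have hAM : 0 ≤ C * Real.log M := mul_nonneg (by linarith) (Real.log_nonneg hM)
    rcases le_or_gt ‖f z‖ 1 with hz1 | hz1
    · exact (Real.log_nonpos hzpos.le hz1).trans hAM
    · have hw1 : 1 < ‖f w‖ := by
        by_contra! hw1
        obtain ⟨x, hx, hx1⟩ := hD.intermediate_value hw hz hc.norm ⟨hw1, hz1.le⟩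
        exact h1 x hx hx1
      have := h z hz w hw
      rw [div_le_iff₀ (Real.log_pos hw1)] at this
      exact this.trans (mul_le_mul_of_nonneg_left (Real.log_le_log hwpos hfw) (by linarith))
  · refine le_max_of_le_left ?_
    have := h z hz w hw
    rw [div_le_iff₀ hwpos] at this
    exact this.trans (mul_le_mul_of_nonneg_left hfw (by linarith))

/-! ### The two implications -/

variable {Ω : Set (EuclideanSpace ℂ (Fin n))} {F : Set (EuclideanSpace ℂ (Fin n) → ℂ)}

theorem IsNormalFamily.exists_minRatio_le (hN : IsNormalFamily F Ω) (hΩ : IsOpen Ω)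
    (hF : ∀ f ∈ F, DifferentiableOn ℂ f Ω) (hF0 : ∀ f ∈ F, ∀ z ∈ Ω, f z ≠ 0)
    {z₀ : EuclideanSpace ℂ (Fin n)} (hz₀ : z₀ ∈ Ω) :
    ∃ r : ℝ, 0 < r ∧ closure (ball z₀ r) ⊆ Ω ∧
      ∃ C : ℝ, ∀ f ∈ F, minRatio f (ball z₀ r) ≤ C := by
  obtain ⟨ε, hε, hεΩ⟩ := nhds_basis_closedBall.mem_iff.1 (hΩ.mem_nhds hz₀)
  obtain ⟨R, hR, rfl⟩ : ∃ R, 0 < R ∧ ε = 2 * R := ⟨ε / 2, by linarith, by ring⟩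
  have hballΩ : ball z₀ (2 * R) ⊆ Ω := ball_subset_closedBall.trans hεΩ
  refine ⟨R / 4, by linarith, closure_ball_subset_closedBall.trans
    ((closedBall_subset_closedBall (by linarith)).trans hεΩ), ?_⟩
  by_contra! hcon
  choose u huF hu using fun k : ℕ => hcon k
  obtain ⟨φ, hφ, ⟨g, hg⟩ | hinf⟩ := hN u huF
  · have hg := Metric.tendstoUniformlyOn_iff.1 (hg _ hεΩ (isCompact_closedBall _ _)) 1 one_pos
    obtain ⟨N, hN⟩ := eventually_atTop.1 hg
    -- No continuity of `g` is assumed, so the bound is taken from `u (φ N)`, which is within 1 of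
    -- `g`.
    obtain ⟨B, hB⟩ := (isCompact_closedBall z₀ (2 * R)).exists_bound_of_continuousOn
      ((hF _ (huF (φ N))).continuousOn.mono hεΩ)
    have hM : 1 < |B| + 3 := by linarith [abs_nonneg B]
    obtain ⟨k, hk⟩ := exists_nat_ge (max 5 (Real.exp (6 * Real.log (|B| + 3))))
    have hkN := hN (max N k) (le_max_left _ _)
    refine (hu (φ (max N k))).not_ge ((minRatio_le_of_norm_lt ((hF _ (huF _)).mono hballΩ)
      (fun w hw => hF0 _ (huF _) w (hballΩ hw)) hM (fun w hw => ?_) hR).trans ?_)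
    · have hw := ball_subset_closedBall hw
      have h1 := hkN w hw
      have h2 := hN N le_rfl w hw
      have h3 := hB w hw
      rw [dist_eq_norm] at h1 h2
      have h4 := norm_sub_norm_le (u (φ (max N k)) w) (g w)
      have h5 := norm_sub_norm_le (g w) (u (φ N) w)
      rw [norm_sub_rev] at h4
      linarith [le_abs_self B]
    · refine EReal.coe_le_coe_iff.2 (hk.trans ?_)
      exact_mod_cast (le_max_right N k).trans (hφ.id_le _)
  · obtain ⟨N, hN⟩ := eventually_atTop.1 (hinf _ hεΩ (isCompact_closedBall _ _) 1)
    refine (hu (φ (max N 3))).not_ge ((minRatio_le_of_one_lt_norm ((hF _ (huF _)).mono hballΩ)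
      (fun w hw => hN _ (le_max_left _ _) w (ball_subset_closedBall hw)) hR).trans ?_)
    refine EReal.coe_le_coe_iff.2 ?_
    exact_mod_cast (le_max_right N 3).trans (hφ.id_le _)

theorem isNormalFamily_of_locally_bounded_propagation (hΩ : IsOpen Ω) (hΩc : IsConnected Ω)
    (hF : ∀ f ∈ F, DifferentiableOn ℂ f Ω)
    (h : ∀ z₀ ∈ Ω, ∃ r > 0, ∀ M : ℝ, ∃ M' : ℝ, ∀ f ∈ F, ∀ z ∈ ball z₀ r, ∀ w ∈ ball z₀ r,
      ‖f w‖ ≤ M → ‖f z‖ ≤ M') : IsNormalFamily F Ω := by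
  intro u hu
  obtain ⟨a, ha⟩ := hΩc.nonempty
  by_cases hbdd : ∃ m : ℕ, ∀ᶠ k in atTop, ‖u k a‖ ≤ m
  · obtain ⟨m, hm⟩ := hbdd
    obtain ⟨N, hN⟩ := eventually_atTop.1 hm
    have hpt : ∀ z ∈ Ω, ∃ M : ℝ, ∀ k, ‖u (k + N) z‖ ≤ M := by
      intro z hz
      refine hΩc.isPreconnected.induction₂' (fun x y => (∃ M : ℝ, ∀ k, ‖u (k + N) x‖ ≤ M) →
        ∃ M : ℝ, ∀ k, ‖u (k + N) y‖ ≤ M) (fun x hx => ?_)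
        (fun x y z _ _ _ hxy hyz hx => hyz (hxy hx)) ha hz ⟨m, fun k => hN _ (by omega)⟩
      obtain ⟨r, hr, hprop⟩ := h x hx
      filter_upwards [nhdsWithin_le_nhds (ball_mem_nhds x hr)] with y hy
      constructor <;> rintro ⟨M, hM⟩ <;> obtain ⟨M', hM'⟩ := hprop M
      · exact ⟨M', fun k => hM' _ (hu _) y hy x (mem_ball_self hr) (hM k)⟩
      · exact ⟨M', fun k => hM' _ (hu _) x (mem_ball_self hr) y hy (hM k)⟩
    obtain ⟨φ, hφ, hg⟩ := exists_subseq_tendstoUniformlyOn_of_locally_bounded hΩ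
      (v := fun k => u (k + N)) (fun k => hF _ (hu _)) (fun z hz => by
        obtain ⟨r, hr, hprop⟩ := h z hz
        obtain ⟨M, hM⟩ := hpt z hz
        obtain ⟨M', hM'⟩ := hprop M
        exact ⟨r, hr, M', fun k w hw => hM' _ (hu _) w hw z (mem_ball_self hr) (hM k)⟩)
    exact ⟨fun k => φ k + N, fun i j hij => by simpa using hφ hij, .inl hg⟩
  · push Not at hbdd
    -- Diagonal choice: `|u (φ k) a| > k` for every `k`.
    obtain ⟨φ, hφ, hlarge⟩ := extraction_forall_of_frequently hbdd
    refine ⟨φ, hφ, .inr ?_⟩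
    have hpt : ∀ z ∈ Ω, ∀ M : ℝ, ∀ᶠ k in atTop, M < ‖u (φ k) z‖ := by
      intro z hz
      refine hΩc.isPreconnected.induction₂' (fun x y =>
        (∀ M : ℝ, ∀ᶠ k in atTop, M < ‖u (φ k) x‖) → ∀ M : ℝ, ∀ᶠ k in atTop, M < ‖u (φ k) y‖)
        (fun x hx => ?_) (fun x y z _ _ _ hxy hyz hx => hyz (hxy hx)) ha hz (fun M => ?_)
      · obtain ⟨r, hr, hprop⟩ := h x hx
        filter_upwards [nhdsWithin_le_nhds (ball_mem_nhds x hr)] with y hy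
        constructor <;> intro hlim M <;> obtain ⟨M', hM'⟩ := hprop M <;>
          filter_upwards [hlim M'] with k hk <;> by_contra! hle
        · exact hk.not_ge (hM' _ (hu _) x (mem_ball_self hr) y hy hle)
        · exact hk.not_ge (hM' _ (hu _) y hy x (mem_ball_self hr) hle)
      · filter_upwards [tendsto_natCast_atTop_atTop.eventually_ge_atTop M] with k hk
        exact hk.trans_lt (hlarge k)
    intro K hKΩ hK M
    refine hK.induction_on (p := fun s => ∀ᶠ k in atTop, ∀ z ∈ s, M < ‖u (φ k) z‖) (by simp)
      (fun s t hst ht => ht.mono fun k hk z hz => hk z (hst hz))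
      (fun s t hs ht => by
        filter_upwards [hs, ht] with k hs ht z hz
        exact hz.elim (hs z) (ht z)) (fun x hx => ?_)
    obtain ⟨r, hr, hprop⟩ := h x (hKΩ hx)
    obtain ⟨M', hM'⟩ := hprop M
    refine ⟨ball x r, nhdsWithin_le_nhds (ball_mem_nhds x hr), ?_⟩
    filter_upwards [hpt x (hKΩ hx) M'] with k hk z hz
    by_contra! hle
    exact hk.not_ge (hM' _ (hu _) x (mem_ball_self hr) z hz hle)

end Mandelbrojt

theorem theorem1p1 {n : ℕ} (hn : 1 ≤ n) (Ω : Set (EuclideanSpace ℂ (Fin n)))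
    (hΩ_open : IsOpen Ω) (hΩ_conn : IsConnected Ω)
    (F : Set (EuclideanSpace ℂ (Fin n) → ℂ))
    (hF_holo : ∀ f ∈ F, DifferentiableOn ℂ f Ω)
    (hF_zero_free : ∀ f ∈ F, ∀ z ∈ Ω, f z ≠ 0) :
    Mandelbrojt.IsNormalFamily F Ω ↔
      ∀ z₀ ∈ Ω, ∃ r₀ : ℝ, 0 < r₀ ∧ closure (Metric.ball z₀ r₀) ⊆ Ω ∧
        ∃ C : ℝ, ∀ f ∈ F, Mandelbrojt.minRatio f (Metric.ball z₀ r₀) ≤ (C : EReal) := by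
  refine ⟨fun hN z₀ hz₀ => hN.exists_minRatio_le hΩ_open hF_holo hF_zero_free hz₀, fun h =>
    Mandelbrojt.isNormalFamily_of_locally_bounded_propagation hΩ_open hΩ_conn hF_holo ?_⟩
  intro z₀ hz₀
  obtain ⟨r, hr, hrΩ, C, hC⟩ := h z₀ hz₀
  have hsub : ball z₀ r ⊆ Ω := subset_closure.trans hrΩ
  refine ⟨r, hr, fun M => ⟨_, fun f hf z hz w hw hfw =>
    Mandelbrojt.norm_le_of_minRatio_le (C := max C 1) (M := max M 1)
      (convex_ball z₀ r).isPreconnected ((hF_holo f hf).continuousOn.mono hsub)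
      (fun x hx => hF_zero_free f hf x (hsub hx))
      ((hC f hf).trans (EReal.coe_le_coe_iff.2 (le_max_left _ _)))
      (le_max_right _ _) (le_max_right _ _) hz hw (hfw.trans (le_max_left _ _))⟩⟩
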